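/- Conventions. Let $G=(V,E)$ be a finite directed graph with $n$ vertices and $m$ edges; every vertex reaches itself. A *shortcut* for $G$ is a set $H$ of additional directed edges, i.e. of pairs $(u,v)\notin E$ with $u\ne v$, such that for some $D$ and all $s,t\in V$: if $t$ is not reachable from $s$ in $G$, it is not reachable from $s$ in $G\cup H$; if $t$ is reachable from $s$ in $G$, it can be reached from $s$ by at most $D$ edges of $G\cup H$. A shortcut $H$ is *certified* if for every $(u,v)\in H$ there is $w\in V$ with $(u,w),(w,v)\in E\cup H$. The *certification complexity* of a shortcut $H$ is the smallest size of a certified shortcut $H'\supseteq H$. A *chain* is a sequence of distinct vertices each of which can reach the next one in $G$; its *edges* are the pairs of consecutive vertices. An *$\ell$-chain cover* of $G$ (with constant $K$) is a collection of at most $\ell$ pairwise vertex-disjoint chains such that every directed path of $G$ has at most $K n/\ell$ vertices that lie in no chain. Lemma. For every real $\epsilon\in[0,1/50)$ there are constants $m_1,m_2,a,b,K,c>0$ and $N\in\mathbb N$ such that for every $n\ge N$ there exist a directed acyclic graph $G$ with $n$ vertices whose number of edges $m$ satisfies $m_1 n^{1+\epsilon}\le m\le m_2 n^{1+\epsilon}$,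 an integer $\ell$ with $a\,n^{1/2}\le \ell\le b\,n^{1/2}$, and an $\ell$-chain cover $\mathcal C$ of $G$ with constant $K$, such that every shortcut $H$ for $G$ for which $G\cup H$ contains the edges of all chains in $\mathcal C$ has certification complexity at least $c\, m\, n^{\epsilon}$. -/

import Mathlib

/-- `Reach r s t`: there is a directed path, possibly with no edges, from `s` to `t`
along the relation `r`. -/
def Reach {V : Type*} (r : V → V → Prop) (s t : V) : Prop :=
  Relation.ReflTransGen r s t

/-- `ReachWithin r D s t`: some directed walk `s = x₀, x₁, …, x_k = t` along `r` has at most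
`D` edges (here `l = [x₁, …, x_k]`). -/
def ReachWithin {V : Type*} (r : V → V → Prop) (D : ℕ) (s t : V) : Prop :=
  ∃ l : List V, List.IsChain r (s :: l) ∧ (s :: l).getLast (List.cons_ne_nil s l) = t ∧
    l.length ≤ D

namespace Digraph

variable {V : Type*}

/-- A digraph without directed cycles (in particular without loops). -/
def IsDAG (G : Digraph V) : Prop :=
  ∀ v, ¬ Relation.TransGen G.Adj v v

/-- The number `m` of edges of a (finite) digraph. -/
noncomputable def numEdges (G : Digraph V) : ℕ :=
  {e : V × V | G.Adj e.1 e.2}.ncard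

/-- Adjacency in the graph `G ∪ H`, where `H` is a set of additional directed edges. -/
def AdjWith (G : Digraph V) (H : Finset (V × V)) (u v : V) : Prop :=
  G.Adj u v ∨ (u, v) ∈ H

/-- `H` is a `D`-shortcut: a set of additional edges (pairs of distinct vertices that are not
already edges of `G`) which creates no new reachability, and such that reachable pairs are joined
in `G ∪ H` by at most `D` edges. -/
structure IsShortcutOfDiam (G : Digraph V) (D : ℕ) (H : Finset (V × V)) : Prop where
  ne : ∀ u v, (u, v) ∈ H → u ≠ v
  not_adj : ∀ u v, (u, v) ∈ H → ¬ G.Adj u v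
  not_reach : ∀ s t, ¬ Reach G.Adj s t → ¬ Reach (G.AdjWith H) s t
  reach : ∀ s t, Reach G.Adj s t → ReachWithin (G.AdjWith H) D s t

/-- A shortcut of whatever diameter. -/
def IsShortcut (G : Digraph V) (H : Finset (V × V)) : Prop :=
  ∃ D, G.IsShortcutOfDiam D H

/-- Every edge `(u, v)` of `H` has two edges `(u, w)`, `(w, v)` of `G ∪ H` certifying it. -/
def IsCertified (G : Digraph V) (H : Finset (V × V)) : Prop :=
  ∀ u v, (u, v) ∈ H → ∃ w, G.AdjWith H u w ∧ G.AdjWith H w v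

/-- The smallest size of a certified shortcut containing `H`. The set of sizes is nonempty for
every shortcut `H` of a finite digraph, see `exists_certified_superset`. -/
noncomputable def certComplexity (G : Digraph V) (H : Finset (V × V)) : ℕ :=
  sInf {k | ∃ H' : Finset (V × V), H ⊆ H' ∧ G.IsShortcut H' ∧ G.IsCertified H' ∧ H'.card = k}

/-- A chain: a sequence of distinct vertices, each of which can reach the next one. -/
def IsVertexChain (G : Digraph V) (c : List V) : Prop :=
  c.Nodup ∧ c.IsChain (Reach G.Adj)

/-- A directed path, given by its sequence of vertices. -/
def IsDiPath (G : Digraph V) (p : List V) : Prop :=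
  p.Nodup ∧ p.IsChain G.Adj

/-- `C` is an `ℓ`-chain cover of `G`, where `K` is the constant in the bound `O(n / ℓ)` on the
number of vertices of a path that lie in no chain. -/
structure IsChainCover [Fintype V] (G : Digraph V) (ℓ : ℕ) (K : ℝ) (C : Finset (List V)) :
    Prop where
  card_le : C.card ≤ ℓ
  chain : ∀ c ∈ C, G.IsVertexChain c
  disjoint : ∀ c ∈ C, ∀ d ∈ C, c ≠ d → List.Disjoint c d
  uncovered : ∀ p, G.IsDiPath p →
    (({v | v ∈ p ∧ ∀ c ∈ C, v ∉ c} : Set V).ncard : ℝ) ≤ K * ((Fintype.card V : ℝ) / ℓ)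

/-- `G ∪ H` contains the edges of all chains of `C`: an edge of a chain is a pair `(u, v)` of
consecutive vertices, and `H` holds all of these that are not edges of `G` already. -/
def ContainsChainEdges (G : Digraph V) (C : Finset (List V)) (H : Finset (V × V)) : Prop :=
  ∀ c ∈ C, c.IsChain (G.AdjWith H)

/-- Adding pairs that are already reachable gives a shortcut. -/
theorem isShortcut_of_reach [Fintype V] {G : Digraph V} {H : Finset (V × V)}
    (h1 : ∀ u v, (u, v) ∈ H → u ≠ v) (h2 : ∀ u v, (u, v) ∈ H → ¬ G.Adj u v)
    (h3 : ∀ u v, (u, v) ∈ H → Reach G.Adj u v) : G.IsShortcut H := by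
  classical
  have key : ∀ p : V × V, ∃ D, Reach G.Adj p.1 p.2 → ReachWithin (G.AdjWith H) D p.1 p.2 := by
    rintro ⟨s, t⟩
    by_cases h : Reach G.Adj s t
    · obtain ⟨l, hl, hl'⟩ := List.exists_isChain_cons_of_relationReflTransGen h
      exact ⟨l.length, fun _ => ⟨l, hl.imp fun _ _ h => Or.inl h, hl', le_rfl⟩⟩
    · exact ⟨0, fun h' => absurd h' h⟩
  choose D hD using key
  refine ⟨Finset.univ.sup D, h1, h2, fun s t hst hst' => hst ?_, fun s t hst => ?_⟩
  · clear hst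
    unfold Reach at hst'
    induction hst' with
    | refl => exact Relation.ReflTransGen.refl
    | tail _ hbc ih =>
      rcases hbc with hbc | hbc
      · exact Relation.ReflTransGen.tail ih hbc
      · exact Relation.ReflTransGen.trans ih (h3 _ _ hbc)
  · obtain ⟨l, a, b, c⟩ := hD (s, t) hst
    exact ⟨l, a, b, c.trans (Finset.le_sup (f := D) (Finset.mem_univ (s, t)))⟩

/-- Every shortcut of a finite digraph extends to a certified one. -/
theorem exists_certified_superset [Fintype V] {G : Digraph V} {H : Finset (V × V)}
    (hH : G.IsShortcut H) :
    ∃ H' : Finset (V × V), H ⊆ H' ∧ G.IsShortcut H' ∧ G.IsCertified H' := by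
  classical
  obtain ⟨D, hD⟩ := hH
  have mem : ∀ u v, (u, v) ∈ (Finset.univ.filter fun e : V × V =>
      e.1 ≠ e.2 ∧ ¬ G.Adj e.1 e.2 ∧ Reach G.Adj e.1 e.2) ↔
      u ≠ v ∧ ¬ G.Adj u v ∧ Reach G.Adj u v := by simp
  refine ⟨Finset.univ.filter fun e : V × V =>
      e.1 ≠ e.2 ∧ ¬ G.Adj e.1 e.2 ∧ Reach G.Adj e.1 e.2, ?_, ?_, ?_⟩
  · rintro ⟨u, v⟩ huv
    refine (mem u v).2 ⟨hD.ne u v huv, hD.not_adj u v huv, ?_⟩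
    by_contra hcon
    exact hD.not_reach u v hcon (Relation.ReflTransGen.single (Or.inr huv))
  · exact isShortcut_of_reach (fun u v h => ((mem u v).1 h).1) (fun u v h => ((mem u v).1 h).2.1)
      fun u v h => ((mem u v).1 h).2.2
  · intro u v huv
    obtain ⟨hne, hna, hr⟩ := (mem u v).1 huv
    clear huv
    unfold Reach at hr
    induction hr using Relation.ReflTransGen.head_induction_on with
    | refl => exact absurd rfl hne
    | head hac hcb ih =>
      rename_i a c
      by_cases hcv : c = v
      · exact absurd (hcv ▸ hac) hna
      · refine ⟨c, Or.inl hac, ?_⟩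
        by_cases hadj : G.Adj c v
        · exact Or.inl hadj
        · exact Or.inr ((mem c v).2 ⟨hcv, hadj, hcb⟩)

end Digraph

/-! Vertices form layers of `w` residues, and each has `s` edges into the next layer. A line uses
one edge number throughout the even layers and another throughout the odd ones, which gives `s ^ 2`
directions. The shift of edge `a` has a linear part, in a separate digit for each parity, and a
quadratic part. Hence, over at most `s ^ 2` layers, a path with the same endpoints as a line has the
same first moments and the same second moment, and strict convexity forces it to be that line
(`eq_lineDigit_of_sum_eq`).

A vertex whose layer is `r` modulo `s ^ 2` is assigned to its line of direction `r`. These chains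
partition the vertices, and there are at most `w * s ^ 2`, about `√n`, of them. Their edges jump `s
^ 2` layers. Any certifying vertex must lie on the line, so certification splits the jump
recursively into `s ^ 2 - 1` shortcut edges (`card_ge`). A pair at least two layers apart shows both
digits of its direction and so belongs to a single segment (`eq_of_eq`): nothing is shared. With `s`
about `n ^ ε` and `m` about `n * s`, the total `n * s ^ 2` has order `m * n ^ ε`. -/

open Finset

/-! ### Arithmetic of displacements -/

/-- The displacement, within its layer, of the `a`-th edge leaving layer `t`. -/
def stepShift (s t a : ℕ) : ℕ :=
  (if Even t then a else s ^ 3 * a) + s ^ 6 * a ^ 2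

/-- The line with index `r` uses edge number `r % s` in even layers and `r / s` in odd ones. -/
def lineDigit (s r t : ℕ) : ℕ :=
  if Even t then r % s else r / s

/-- The total displacement of the line with index `r` between the layers `t` and `t'`. -/
def lineShift (s r t t' : ℕ) : ℕ :=
  ∑ i ∈ Ico t t', stepShift s i (lineDigit s r i)

/-- The digraph on `Fin n` with layers of size `w`, in which each vertex has `s` edges to the next
layer. -/
def layeredGraph (n s w : ℕ) : Digraph (Fin n) where
  Adj u v := (v : ℕ) / w = (u : ℕ) / w + 1 ∧
    ∃ a < s, ((v : ℕ) : ZMod w) = ((u : ℕ) : ZMod w) + (stepShift s ((u : ℕ) / w) a : ℕ)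

theorem lineDigit_lt {s r t : ℕ} (hr : r < s ^ 2) : lineDigit s r t < s := by
  have hs : 0 < s := by
    rcases Nat.eq_zero_or_pos s with rfl | h
    · simp at hr
    · exact h
  unfold lineDigit
  split_ifs
  · exact Nat.mod_lt _ hs
  · rw [Nat.div_lt_iff_lt_mul hs]; nlinarith

theorem lineShift_add (s r : ℕ) {t t' t'' : ℕ} (h : t ≤ t') (h' : t' ≤ t'') :
    lineShift s r t t' + lineShift s r t' t'' = lineShift s r t t'' :=
  Finset.sum_Ico_consecutive _ h h'

theorem lineShift_succ (s r t : ℕ) :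
    lineShift s r t (t + 1) = stepShift s t (lineDigit s r t) := by
  simp [lineShift]

theorem eq_of_digits_eq {B x y z x' y' z' : ℕ} (hx : x < B) (hx' : x' < B) (hy : y < B)
    (hy' : y' < B) (h : x + B * y + B ^ 2 * z = x' + B * y' + B ^ 2 * z') :
    x = x' ∧ y = y' ∧ z = z' := by
  have hB : 0 < B := by omega
  have h1 : x + B * (y + B * z) = x' + B * (y' + B * z') := by linarith [h]
  have e1 : x = x' := by
    have := congrArg (· % B) h1
    simpa [Nat.add_mul_mod_self_left, Nat.mod_eq_of_lt hx, Nat.mod_eq_of_lt hx'] using this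
  subst e1
  have h2 : y + B * z = y' + B * z' := Nat.eq_of_mul_eq_mul_left hB (by omega)
  have e2 : y = y' := by
    have := congrArg (· % B) h2
    simpa [Nat.add_mul_mod_self_left, Nat.mod_eq_of_lt hy, Nat.mod_eq_of_lt hy'] using this
  subst e2
  exact ⟨rfl, rfl, Nat.eq_of_mul_eq_mul_left hB (by omega)⟩

/-- In base `s ^ 3` the digits of a total displacement are the two first moments, one per parity,
and the second moment. -/
theorem sum_stepShift (s : ℕ) (I : Finset ℕ) (a : ℕ → ℕ) :
    ∑ i ∈ I, stepShift s i (a i) = (∑ i ∈ I, if Even i then a i else 0) +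
      s ^ 3 * (∑ i ∈ I, if Even i then 0 else a i) + (s ^ 3) ^ 2 * ∑ i ∈ I, a i ^ 2 := by
  rw [mul_sum, mul_sum, ← sum_add_distrib, ← sum_add_distrib]
  refine sum_congr rfl fun i _ => ?_
  unfold stepShift
  split_ifs <;> ring

/-- Each of at most `s ^ 2` terms is at most `s - 1`, so the two lower digits never carry in base `s
^ 3`. -/
theorem sum_lt_pow_three {s t t' : ℕ} (hs : 0 < s) (ht : t' ≤ t + s ^ 2) (f : ℕ → ℕ)
    (hf : ∀ i, f i < s) : ∑ i ∈ Ico t t', f i < s ^ 3 := by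
  have h1 : ∑ i ∈ Ico t t', f i ≤ (Ico t t').card • (s - 1) :=
    sum_le_card_nsmul _ _ _ fun i _ => by have := hf i; omega
  have h2 : (Ico t t').card ≤ s ^ 2 := by simp; omega
  obtain ⟨k, rfl⟩ : ∃ k, s = k + 1 := ⟨s - 1, by omega⟩
  simp only [smul_eq_mul, Nat.add_sub_cancel] at h1
  nlinarith [Nat.mul_le_mul_right k h2, sq_nonneg (k + 1)]

theorem stepShift_lt {s t a : ℕ} (ha : a < s) : stepShift s t a < s ^ 8 := by
  obtain ⟨k, rfl⟩ : ∃ k, s = k + 1 := ⟨s - 1, by omega⟩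
  have h1 : stepShift (k + 1) t a ≤ (k + 1) ^ 3 * k + (k + 1) ^ 6 * k ^ 2 := by
    have hak : a ≤ k := by omega
    unfold stepShift
    refine Nat.add_le_add ?_ (by gcongr)
    split_ifs
    · exact hak.trans (Nat.le_mul_of_pos_left _ (by positivity))
    · gcongr
  refine h1.trans_lt ?_
  have h2 : (k + 1) ^ 3 ≤ (k + 1) ^ 6 := Nat.pow_le_pow_right (by omega) (by omega)
  have h3 : 0 < (k + 1) ^ 6 := by positivity
  calc (k + 1) ^ 3 * k + (k + 1) ^ 6 * k ^ 2 ≤ (k + 1) ^ 6 * k + (k + 1) ^ 6 * k ^ 2 := by gcongr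
    _ = (k + 1) ^ 6 * (k + k ^ 2) := by ring
    _ < (k + 1) ^ 6 * (k + 1) ^ 2 := by gcongr; nlinarith
    _ = (k + 1) ^ 8 := by ring

/-- Once `s ^ 10 ≤ w` there is no wrap-around: congruences of such displacements modulo `w` are
equalities in `ℕ`. -/
theorem sum_stepShift_lt {s t t' : ℕ} (hs : 0 < s) (ht : t' ≤ t + s ^ 2) (a : ℕ → ℕ)
    (ha : ∀ i, a i < s) : ∑ i ∈ Ico t t', stepShift s i (a i) < s ^ 10 := by
  rcases (Ico t t').eq_empty_or_nonempty with h | h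
  · rw [h]; simp; positivity
  · calc ∑ i ∈ Ico t t', stepShift s i (a i) < ∑ _i ∈ Ico t t', s ^ 8 :=
        sum_lt_sum_of_nonempty h fun i _ => stepShift_lt (ha i)
      _ = (Ico t t').card * s ^ 8 := by simp
      _ ≤ s ^ 2 * s ^ 8 := by gcongr; simp; omega
      _ = s ^ 10 := by ring

/-- Over at most `s ^ 2` layers, a path is determined by the total displacement, if that is the
displacement of a line. -/
theorem eq_lineDigit_of_sum_eq {s w t t' r : ℕ} (hw : s ^ 10 ≤ w) (ht : t' ≤ t + s ^ 2)
    (hr : r < s ^ 2) {a : ℕ → ℕ} (ha : ∀ i, a i < s)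
    (h : ((∑ i ∈ Ico t t', stepShift s i (a i) : ℕ) : ZMod w) = (lineShift s r t t' : ℕ)) :
    ∀ i ∈ Ico t t', a i = lineDigit s r i := by
  have hs : 0 < s := (Nat.zero_le _).trans_lt (ha 0)
  have hd : ∀ i, lineDigit s r i < s := fun i => lineDigit_lt hr
  rw [ZMod.natCast_eq_natCast_iff', Nat.mod_eq_of_lt ((sum_stepShift_lt hs ht a ha).trans_le hw),
    lineShift, Nat.mod_eq_of_lt ((sum_stepShift_lt hs ht _ hd).trans_le hw),
    sum_stepShift, sum_stepShift] at h
  obtain ⟨h1, h2, h3⟩ := eq_of_digits_eq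
    (sum_lt_pow_three hs ht _ fun i => by split_ifs; exacts [ha i, hs])
    (sum_lt_pow_three hs ht _ fun i => by split_ifs; exacts [hd i, hs])
    (sum_lt_pow_three hs ht _ fun i => by split_ifs; exacts [hs, ha i])
    (sum_lt_pow_three hs ht _ fun i => by split_ifs; exacts [hs, hd i]) h
  -- Write `(a - d) ^ 2 = (a ^ 2 - d ^ 2) - 2 * d * (a - d)`. Since the line's digit `d` is constant
  -- on each parity class, the three digit equalities make the sum vanish.
  have key : ∑ i ∈ Ico t t', ((a i : ℤ) - lineDigit s r i) ^ 2 = 0 := by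
    zify at h1 h2 h3
    have e : ∀ i, ((a i : ℤ) - lineDigit s r i) ^ 2 =
        ((a i : ℤ) ^ 2 - (lineDigit s r i : ℤ) ^ 2)
        - 2 * ((r % s : ℕ) : ℤ) *
          ((if Even i then (a i : ℤ) else 0) - (if Even i then (lineDigit s r i : ℤ) else 0))
        - 2 * ((r / s : ℕ) : ℤ) *
          ((if Even i then 0 else (a i : ℤ)) - (if Even i then 0 else (lineDigit s r i : ℤ))) := by
      intro i
      unfold lineDigit
      split_ifs <;> ring
    simp_rw [e, sum_sub_distrib, ← mul_sum, sum_sub_distrib]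
    rw [h1, h2, h3]
    ring
  intro i hi
  have := (sum_eq_zero_iff_of_nonneg (fun i _ => sq_nonneg _)).1 key i hi
  have := pow_eq_zero_iff (two_ne_zero) |>.1 this
  omega

/-! ### Paths and lines in the layered graph -/

section layeredGraph

variable {n s w : ℕ}

theorem eq_of_layer_eq {u v : Fin n} (h : (u : ℕ) / w = (v : ℕ) / w)
    (h' : ((u : ℕ) : ZMod w) = ((v : ℕ) : ZMod w)) : u = v := by
  rw [ZMod.natCast_eq_natCast_iff'] at h'
  ext
  rw [← Nat.div_add_mod (u : ℕ) w, ← Nat.div_add_mod (v : ℕ) w, h, h']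

/-- The last layer may be incomplete; the bound on `t` says that layer `t` is full. -/
theorem exists_vertex (hw : 0 < w) {t : ℕ} (ht : (t + 1) * w ≤ n) (q : ZMod w) :
    ∃ v : Fin n, (v : ℕ) / w = t ∧ ((v : ℕ) : ZMod w) = q := by
  have : NeZero w := ⟨hw.ne'⟩
  have hq := ZMod.val_lt q
  refine ⟨⟨t * w + q.val, by linarith⟩, ?_, by simp⟩
  simp [Nat.add_comm (t * w), Nat.add_mul_div_right _ _ hw, Nat.div_eq_of_lt hq]

theorem layer_mul_le (v : Fin n) : ((v : ℕ) / w) * w ≤ v := Nat.div_mul_le_self _ _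

theorem layeredGraph_layer_lt {u v : Fin n}
    (h : Relation.TransGen (layeredGraph n s w).Adj u v) : (u : ℕ) / w < (v : ℕ) / w := by
  induction h with
  | single h => have := h.1; omega
  | tail _ h ih => have := h.1; omega

theorem layeredGraph_isDAG : (layeredGraph n s w).IsDAG :=
  fun _ h => lt_irrefl _ (layeredGraph_layer_lt h)

theorem exists_digits_of_reach {u v : Fin n} (hs : 0 < s)
    (h : Reach (layeredGraph n s w).Adj u v) :
    (u : ℕ) / w ≤ (v : ℕ) / w ∧ ∃ a : ℕ → ℕ, (∀ i, a i < s) ∧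
      ((v : ℕ) : ZMod w) = ((u : ℕ) : ZMod w) +
        (∑ i ∈ Ico ((u : ℕ) / w) ((v : ℕ) / w), stepShift s i (a i) : ℕ) := by
  unfold Reach at h
  induction h with
  | refl => exact ⟨le_rfl, fun _ => 0, fun _ => hs, by simp⟩
  | @tail x y _ hxy ih =>
    obtain ⟨hle, a, ha, hx⟩ := ih
    obtain ⟨hl, b, hb, hy⟩ := hxy
    refine ⟨by omega, fun i => if i < (x : ℕ) / w then a i else b,
      fun i => by dsimp only; split_ifs; exacts [ha i, hb], ?_⟩
    rw [hl, sum_Ico_succ_top hle, hy, hx]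
    have : ∑ i ∈ Ico ((u : ℕ) / w) ((x : ℕ) / w),
        stepShift s i (if i < (x : ℕ) / w then a i else b) =
        ∑ i ∈ Ico ((u : ℕ) / w) ((x : ℕ) / w), stepShift s i (a i) :=
      sum_congr rfl fun i hi => by rw [if_pos (mem_Ico.1 hi).2]
    rw [this]
    simp [add_assoc]

/-- A vertex between two vertices of a line, at most `s ^ 2` layers apart, is on the line. -/
theorem mem_line_of_reach {u v x : Fin n} {r : ℕ} (hw : s ^ 10 ≤ w) (hr : r < s ^ 2)
    (hd : (v : ℕ) / w ≤ (u : ℕ) / w + s ^ 2)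
    (hv : ((v : ℕ) : ZMod w) = ((u : ℕ) : ZMod w) +
      (lineShift s r ((u : ℕ) / w) ((v : ℕ) / w) : ℕ))
    (h1 : Reach (layeredGraph n s w).Adj u x) (h2 : Reach (layeredGraph n s w).Adj x v) :
    ((x : ℕ) : ZMod w) = ((u : ℕ) : ZMod w) +
      (lineShift s r ((u : ℕ) / w) ((x : ℕ) / w) : ℕ) := by
  have hs : 0 < s := (Nat.zero_le _).trans_lt (lineDigit_lt (t := 0) hr)
  obtain ⟨hl1, a, ha, hx⟩ := exists_digits_of_reach hs h1
  obtain ⟨hl2, b, hb, hy⟩ := exists_digits_of_reach hs h2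
  -- Concatenating the two paths gives one path with the endpoints of the line, to which uniqueness
  -- applies.
  set c : ℕ → ℕ := fun i => if i < (x : ℕ) / w then a i else b i with hc
  have e1 : ∑ i ∈ Ico ((u : ℕ) / w) ((x : ℕ) / w), stepShift s i (c i) =
      ∑ i ∈ Ico ((u : ℕ) / w) ((x : ℕ) / w), stepShift s i (a i) :=
    sum_congr rfl fun i hi => by simp only [hc]; rw [if_pos (mem_Ico.1 hi).2]
  have e2 : ∑ i ∈ Ico ((x : ℕ) / w) ((v : ℕ) / w), stepShift s i (c i) =
      ∑ i ∈ Ico ((x : ℕ) / w) ((v : ℕ) / w), stepShift s i (b i) :=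
    sum_congr rfl fun i hi => by simp only [hc]; rw [if_neg (not_lt.2 (mem_Ico.1 hi).1)]
  have hcs : ∀ i, c i < s := fun i => by
    simp only [hc]; split_ifs; exacts [ha i, hb i]
  have hsum : ((∑ i ∈ Ico ((u : ℕ) / w) ((v : ℕ) / w), stepShift s i (c i) : ℕ) : ZMod w) =
      (lineShift s r ((u : ℕ) / w) ((v : ℕ) / w) : ℕ) := by
    rw [← sum_Ico_consecutive _ hl1 hl2, e1, e2, Nat.cast_add]
    rw [hy, hx, add_assoc] at hv
    exact add_left_cancel hv
  have huniq := eq_lineDigit_of_sum_eq hw hd hr hcs hsum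
  rw [hx, ← e1, lineShift]
  congr 2
  refine sum_congr rfl fun i hi => ?_
  rw [huniq i (Ico_subset_Ico_right hl2 hi)]

theorem reach_of_line (hw : 0 < w) {r : ℕ} (hr : r < s ^ 2) {u : Fin n} (k : ℕ) :
    ∀ v : Fin n, (v : ℕ) / w = (u : ℕ) / w + k →
      ((v : ℕ) : ZMod w) = ((u : ℕ) : ZMod w) +
        (lineShift s r ((u : ℕ) / w) ((v : ℕ) / w) : ℕ) →
      Reach (layeredGraph n s w).Adj u v := by
  induction k with
  | zero =>
    intro v hl hv
    have : u = v := eq_of_layer_eq hl.symm (by rw [hv, hl]; simp [lineShift])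
    exact this ▸ Relation.ReflTransGen.refl
  | succ k ih =>
    intro v hl hv
    -- The penultimate layer precedes that of `v`, hence is full.
    have hlt : ((u : ℕ) / w + k + 1) * w ≤ n := by
      have := layer_mul_le (w := w) v
      rw [hl, ← add_assoc] at this
      omega
    obtain ⟨x, hxl, hx⟩ := exists_vertex hw hlt
      (((u : ℕ) : ZMod w) + (lineShift s r ((u : ℕ) / w) ((u : ℕ) / w + k) : ℕ))
    refine Relation.ReflTransGen.tail (ih x hxl (by rw [hx, hxl])) ⟨by omega, lineDigit s r (x / w),
      lineDigit_lt hr, ?_⟩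
    rw [hv, hx, hl, ← lineShift_add s r (Nat.le_add_right _ k)
      (Nat.add_le_add_left (Nat.le_succ k) _), hxl, Nat.cast_add, ← add_assoc, Nat.succ_eq_add_one,
      ← add_assoc, lineShift_succ]

/-! ### The chain cover -/

/-- The vertices of the chain with index `k`: they lie on a common line with index `k.2`, in the
layers that are `k.2` modulo `s ^ 2`. -/
def lineChain (n s w : ℕ) (k : ZMod w × ℕ) : List (Fin n) :=
  (List.finRange n).filter fun v => (v : ℕ) / w % s ^ 2 = k.2 ∧
    ((v : ℕ) : ZMod w) = k.1 + (lineShift s k.2 0 ((v : ℕ) / w) : ℕ)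

theorem mem_lineChain {k : ZMod w × ℕ} {v : Fin n} :
    v ∈ lineChain n s w k ↔ (v : ℕ) / w % s ^ 2 = k.2 ∧
      ((v : ℕ) : ZMod w) = k.1 + (lineShift s k.2 0 ((v : ℕ) / w) : ℕ) := by
  simp [lineChain]

theorem lineChain_pairwise (k : ZMod w × ℕ) : (lineChain n s w k).Pairwise (· < ·) :=
  (List.pairwise_lt_finRange n).filter _

theorem lineShift_of_mem_lineChain {k : ZMod w × ℕ} {u v : Fin n} (hu : u ∈ lineChain n s w k)
    (hv : v ∈ lineChain n s w k) (h : (u : ℕ) / w ≤ (v : ℕ) / w) :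
    ((v : ℕ) : ZMod w) = ((u : ℕ) : ZMod w) +
      (lineShift s k.2 ((u : ℕ) / w) ((v : ℕ) / w) : ℕ) := by
  rw [(mem_lineChain.1 hu).2, (mem_lineChain.1 hv).2, ← lineShift_add s k.2 (Nat.zero_le _) h,
    Nat.cast_add, add_assoc]

theorem lineChain_isVertexChain (hw : 0 < w) (hs : 0 < s) (k : ZMod w × ℕ) :
    (layeredGraph n s w).IsVertexChain (lineChain n s w k) := by
  refine ⟨(lineChain_pairwise k).imp fun h => h.ne, ?_⟩
  -- The order of `Fin n` refines the order of layers, so the sorted list runs forward along the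
  -- line.
  refine List.Pairwise.isChain ((lineChain_pairwise k).imp_of_mem fun {u v} hu hv h => ?_)
  have hl : (u : ℕ) / w ≤ (v : ℕ) / w := Nat.div_le_div_right (Fin.le_def.1 h.le)
  refine reach_of_line hw (r := k.2) ?_ ((v : ℕ) / w - (u : ℕ) / w) v (by omega)
    (lineShift_of_mem_lineChain hu hv hl)
  rw [← (mem_lineChain.1 hu).1]
  exact Nat.mod_lt _ (by positivity)

theorem eq_of_mem_lineChain {k k' : ZMod w × ℕ} {v : Fin n} (h : v ∈ lineChain n s w k)
    (h' : v ∈ lineChain n s w k') : k = k' := by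
  obtain ⟨h1, h2⟩ := mem_lineChain.1 h
  obtain ⟨h1', h2'⟩ := mem_lineChain.1 h'
  have e : k.2 = k'.2 := h1.symm.trans h1'
  rw [h2, e] at h2'
  exact Prod.ext (add_right_cancel h2') e

/-- The key of the chain through `v`. -/
def lineKey (s w v : ℕ) : ZMod w × ℕ :=
  ((v : ZMod w) - (lineShift s (v / w % s ^ 2) 0 (v / w) : ℕ), v / w % s ^ 2)

theorem mem_lineChain_lineKey (v : Fin n) : v ∈ lineChain n s w (lineKey s w v) := by
  simp [mem_lineChain, lineKey]

/-- All chains `lineChain`. -/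
noncomputable def lineCover (n s w : ℕ) [NeZero w] : Finset (List (Fin n)) := by
  classical
  exact ((univ : Finset (ZMod w)) ×ˢ range (s ^ 2)).image (lineChain n s w)

theorem lineChain_lineKey_mem_lineCover [NeZero w] (hs : 0 < s) (v : Fin n) :
    lineChain n s w (lineKey s w v) ∈ lineCover n s w := by
  classical
  refine mem_image_of_mem _ (mem_product.2 ⟨mem_univ _, mem_range.2 ?_⟩)
  exact Nat.mod_lt _ (by positivity)

theorem lineCover_isChainCover [NeZero w] (hs : 0 < s) :
    (layeredGraph n s w).IsChainCover (w * s ^ 2) 1 (lineCover n s w) where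
  card_le := by
    classical
    refine card_image_le.trans ?_
    simp [ZMod.card]
  chain := by
    classical
    intro c hc
    obtain ⟨k, _, rfl⟩ := mem_image.1 hc
    exact lineChain_isVertexChain (NeZero.pos w) hs k
  disjoint := by
    classical
    intro c hc d hd hcd v hv hv'
    obtain ⟨k, _, rfl⟩ := mem_image.1 hc
    obtain ⟨k', _, rfl⟩ := mem_image.1 hd
    exact hcd (by rw [eq_of_mem_lineChain hv hv'])
  uncovered := by
    intro p _
    have : ({v | v ∈ p ∧ ∀ c ∈ lineCover n s w, v ∉ c} : Set (Fin n)) = ∅ := by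
      refine Set.eq_empty_of_forall_notMem fun v hv => ?_
      exact hv.2 _ (lineChain_lineKey_mem_lineCover hs v) (mem_lineChain_lineKey v)
    rw [this, Set.ncard_empty, Nat.cast_zero, one_mul]
    exact div_nonneg (Nat.cast_nonneg _) (Nat.cast_nonneg _)

end layeredGraph

/-! ### Sorted lists, splitting intervals, and shortcuts -/

/-- In a sorted list, a relation between consecutive elements holds between any two elements with
no element of the list in between. -/
theorem List.IsChain.rel_of_forall_not_between {α : Type*} [LinearOrder α] {R : α → α → Prop}
    {l : List α} (hl : l.Pairwise (· < ·)) (hR : l.IsChain R) {u v : α} (hu : u ∈ l) (hv : v ∈ l)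
    (huv : u < v) (h : ∀ y ∈ l, u < y → v ≤ y) : R u v := by
  obtain ⟨l₁, l₂, rfl⟩ := List.append_of_mem hu
  have h1 := List.pairwise_append.1 hl
  have h2 := List.pairwise_cons.1 h1.2.1
  have hv2 : v ∈ l₂ := by
    rcases List.mem_append.1 hv with hv | hv
    · exact absurd (h1.2.2 v hv u (by simp)) huv.not_gt
    · rcases List.mem_cons.1 hv with rfl | hv
      · exact absurd huv (lt_irrefl _)
      · exact hv
  cases l₂ with
  | nil => simp at hv2
  | cons x l₂ =>
    have hR' : R u x := (List.isChain_cons_cons.1 (List.isChain_append.1 hR).2.1).1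
    have hx : v ≤ x := h x (by simp) (h2.1 x (by simp))
    rcases List.mem_cons.1 hv2 with rfl | hv2
    · exact hR'
    · exact absurd ((List.pairwise_cons.1 h2.2).1 v hv2) hx.not_gt

/-- A family of intervals in which every interval of length at least two splits contains at least
`j - i - 1` intervals inside `(i, j)`. -/
theorem card_intervals_ge {P : Finset (ℕ × ℕ)}
    (h : ∀ i j, (i, j) ∈ P → ∃ k, i < k ∧ k < j ∧
      ((i, k) ∈ P ∨ k = i + 1) ∧ ((k, j) ∈ P ∨ j = k + 1)) (d : ℕ) :
    ∀ i j, (i, j) ∈ P → j = i + d →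
      j ≤ #{e ∈ P | i ≤ e.1 ∧ e.2 ≤ j} + i + 1 := by
  induction d using Nat.strong_induction_on with
  | _ d ih =>
    intro i j hij hd
    obtain ⟨k, hik, hkj, h1, h2⟩ := h i j hij
    have hA : k ≤ #{e ∈ P | i ≤ e.1 ∧ e.2 ≤ k} + i + 1 := by
      rcases h1 with h1 | h1
      · exact ih (k - i) (by omega) i k h1 (by omega)
      · omega
    have hB : j ≤ #{e ∈ P | k ≤ e.1 ∧ e.2 ≤ j} + k + 1 := by
      rcases h2 with h2 | h2
      · exact ih (j - k) (by omega) k j h2 (by omega)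
      · omega
    have hlt : ∀ e ∈ P, e.1 < e.2 := fun e he => by
      obtain ⟨k, _, _, _⟩ := h e.1 e.2 he
      omega
    have hdisj : Disjoint {e ∈ P | i ≤ e.1 ∧ e.2 ≤ k} {e ∈ P | k ≤ e.1 ∧ e.2 ≤ j} := by
      rw [disjoint_left]
      intro e he he'
      rw [mem_filter] at he he'
      have := hlt e he.1
      omega
    -- The two halves and the interval itself give `(k - i - 1) + (j - k - 1) + 1 = j - i - 1`.
    have hsub : insert (i, j) ({e ∈ P | i ≤ e.1 ∧ e.2 ≤ k} ∪ {e ∈ P | k ≤ e.1 ∧ e.2 ≤ j}) ⊆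
        {e ∈ P | i ≤ e.1 ∧ e.2 ≤ j} := by
      intro e he
      rcases mem_insert.1 he with rfl | he
      · exact mem_filter.2 ⟨hij, le_rfl, le_rfl⟩
      · rcases mem_union.1 he with he | he <;> rw [mem_filter] at he ⊢
        · exact ⟨he.1, by omega, by omega⟩
        · exact ⟨he.1, by omega, by omega⟩
    have hc := card_le_card hsub
    rw [card_insert_of_notMem, card_union_of_disjoint hdisj] at hc
    · omega
    · intro he
      rcases mem_union.1 he with he | he <;> rw [mem_filter] at he
      · have := he.2.2; dsimp at this; omega
      · have := he.2.1; dsimp at this; omega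

namespace Digraph

theorem IsShortcut.reach_of_adjWith {V : Type*} {G : Digraph V} {H : Finset (V × V)}
    (hH : G.IsShortcut H) {u v : V} (h : G.AdjWith H u v) : Reach G.Adj u v := by
  obtain ⟨D, hD⟩ := hH
  by_contra hcon
  exact hD.not_reach u v hcon (Relation.ReflTransGen.single h)

theorem IsShortcut.ne_of_adjWith {V : Type*} {G : Digraph V} {H : Finset (V × V)}
    (hG : G.IsDAG) (hH : G.IsShortcut H) {u v : V} (h : G.AdjWith H u v) : u ≠ v := by
  obtain ⟨D, hD⟩ := hH
  rcases h with h | h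
  · rintro rfl
    exact hG u (Relation.TransGen.single h)
  · exact hD.ne u v h

end Digraph

/-! ### Cost of certifying the chain edges -/

section lowerBound

variable {n s w : ℕ}

theorem layeredGraph_layer_lt_of_adjWith {H : Finset (Fin n × Fin n)}
    (hH : (layeredGraph n s w).IsShortcut H) {u v : Fin n}
    (h : (layeredGraph n s w).AdjWith H u v) : (u : ℕ) / w < (v : ℕ) / w := by
  rcases Relation.reflTransGen_iff_eq_or_transGen.1 (hH.reach_of_adjWith h) with e | e
  · exact absurd e.symm (hH.ne_of_adjWith layeredGraph_isDAG h)
  · exact layeredGraph_layer_lt e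

/-- `x 0, …, x (s ^ 2)` is the segment of a line from `x 0 = u` to the next vertex of the chain
through `u`. -/
def IsLineSegment (s w : ℕ) (u : Fin n) (x : ℕ → Fin n) : Prop :=
  ∀ i ≤ s ^ 2, (x i : ℕ) / w = (u : ℕ) / w + i ∧ ((x i : ℕ) : ZMod w) = ((u : ℕ) : ZMod w) +
    (lineShift s ((u : ℕ) / w % s ^ 2) ((u : ℕ) / w) ((u : ℕ) / w + i) : ℕ)

theorem exists_isLineSegment (hw : 0 < w) {u : Fin n} (hu : (u : ℕ) + (s ^ 2 + 1) * w ≤ n) :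
    ∃ x, IsLineSegment s w u x := by
  have h : ∀ i, ∃ v : Fin n, i ≤ s ^ 2 → (v : ℕ) / w = (u : ℕ) / w + i ∧
      ((v : ℕ) : ZMod w) = ((u : ℕ) : ZMod w) +
        (lineShift s ((u : ℕ) / w % s ^ 2) ((u : ℕ) / w) ((u : ℕ) / w + i) : ℕ) := by
    intro i
    by_cases hi : i ≤ s ^ 2
    · have hlt : ((u : ℕ) / w + i + 1) * w ≤ n := by
        have h1 := layer_mul_le (w := w) u
        have h2 := Nat.mul_le_mul_right w hi
        linarith [add_mul ((u : ℕ) / w + i) 1 w, add_mul ((u : ℕ) / w) i w, add_mul (s ^ 2) 1 w]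
      obtain ⟨v, hv⟩ := exists_vertex hw hlt _
      exact ⟨v, fun _ => hv⟩
    · exact ⟨u, fun h => absurd h hi⟩
  choose x hx using h
  exact ⟨x, hx⟩

namespace IsLineSegment

variable {u : Fin n} {x : ℕ → Fin n}

theorem zero (hx : IsLineSegment s w u x) : x 0 = u := by
  obtain ⟨h1, h2⟩ := hx 0 (Nat.zero_le _)
  exact eq_of_layer_eq h1 (by rw [h2]; simp [lineShift])

theorem shift (hx : IsLineSegment s w u x) {i j : ℕ} (hij : i ≤ j) (hj : j ≤ s ^ 2) :
    ((x j : ℕ) : ZMod w) = ((x i : ℕ) : ZMod w) +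
      (lineShift s ((u : ℕ) / w % s ^ 2) ((x i : ℕ) / w) ((x j : ℕ) / w) : ℕ) := by
  rw [(hx j hj).2, (hx j hj).1, (hx i (hij.trans hj)).1, (hx i (hij.trans hj)).2,
    ← lineShift_add s _ (Nat.le_add_right _ _) (Nat.add_le_add_left hij _), Nat.cast_add, add_assoc]

/-- Advancing `s ^ 2` layers preserves the layer modulo `s ^ 2`, hence the direction assigned to the
vertex. -/
theorem last_mem_lineChain (hx : IsLineSegment s w u x) :
    x (s ^ 2) ∈ lineChain n s w (lineKey s w u) := by
  obtain ⟨h1, h2⟩ := hx _ le_rfl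
  rw [mem_lineChain, h1, h2]
  refine ⟨by simp [lineKey], ?_⟩
  rw [← lineShift_add _ _ (Nat.zero_le ((u : ℕ) / w)) (Nat.le_add_right _ _)]
  simp only [lineKey, Nat.cast_add]
  ring

/-- The chain edge from `u` is an edge of every shortcut containing the edges of the chains. -/
theorem mem_of_containsChainEdges [NeZero w] (hs : 2 ≤ s) (hx : IsLineSegment s w u x)
    {H : Finset (Fin n × Fin n)}
    (hH : (layeredGraph n s w).ContainsChainEdges (lineCover n s w) H) : (u, x (s ^ 2)) ∈ H := by
  have h4 : 4 ≤ s ^ 2 := by nlinarith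
  obtain ⟨h1, h2⟩ := hx _ le_rfl
  have hlt : u < x (s ^ 2) := by
    by_contra hcon
    have := Nat.div_le_div_right (c := w) (Fin.le_def.1 (not_lt.1 hcon))
    omega
  have hadj : (layeredGraph n s w).AdjWith H u (x (s ^ 2)) := by
    refine List.IsChain.rel_of_forall_not_between (lineChain_pairwise (lineKey s w u))
      (hH _ (lineChain_lineKey_mem_lineCover (by omega) u)) (mem_lineChain_lineKey u)
      hx.last_mem_lineChain hlt fun y hy huy => ?_
    by_contra hcon
    rw [not_le] at hcon
    have l1 := Nat.div_le_div_right (c := w) (Fin.le_def.1 huy.le)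
    have l2 := Nat.div_le_div_right (c := w) (Fin.le_def.1 hcon.le)
    have hmod : (u : ℕ) / w % s ^ 2 = (y : ℕ) / w % s ^ 2 := by
      rw [(mem_lineChain.1 hy).1]; rfl
    -- Layers of one chain are congruent modulo `s ^ 2`, so `y` would share a layer with an endpoint
    -- and coincide with it.
    have hdvd := (Nat.modEq_iff_dvd' l1).1 hmod
    rcases Nat.eq_zero_or_pos ((y : ℕ) / w - (u : ℕ) / w) with h0 | hpos
    · have e : (u : ℕ) / w = (y : ℕ) / w := by omega
      refine huy.ne (eq_of_layer_eq e ?_)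
      rw [lineShift_of_mem_lineChain (mem_lineChain_lineKey u) hy l1, e]
      simp [lineShift]
    · have := Nat.le_of_dvd hpos hdvd
      have e : (y : ℕ) / w = (x (s ^ 2) : ℕ) / w := by omega
      refine hcon.ne (eq_of_layer_eq e ?_)
      rw [lineShift_of_mem_lineChain hy hx.last_mem_lineChain e.le, e]
      simp [lineShift]
  rcases hadj with h | h
  · have := h.1
    omega
  · exact h

open Classical in
/-- Certifying the chain edge from `u` takes `s ^ 2 - 1` edges along the segment. -/
theorem card_ge (hw : s ^ 10 ≤ w) (hs : 2 ≤ s) (hx : IsLineSegment s w u x)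
    {H : Finset (Fin n × Fin n)} (hH : (layeredGraph n s w).IsShortcut H)
    (hc : (layeredGraph n s w).IsCertified H) (hu : (u, x (s ^ 2)) ∈ H) :
    s ^ 2 - 1 ≤ #{e ∈ range (s ^ 2 + 1) ×ˢ range (s ^ 2 + 1) |
      e.1 + 2 ≤ e.2 ∧ (x e.1, x e.2) ∈ H} := by
  have h4 : 4 ≤ s ^ 2 := by nlinarith
  have hr : (u : ℕ) / w % s ^ 2 < s ^ 2 := Nat.mod_lt _ (by omega)
  set P := {e ∈ range (s ^ 2 + 1) ×ˢ range (s ^ 2 + 1) | e.1 + 2 ≤ e.2 ∧ (x e.1, x e.2) ∈ H} with hP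
  have memP : ∀ i j, (i, j) ∈ P ↔ (i < s ^ 2 + 1 ∧ j < s ^ 2 + 1) ∧ i + 2 ≤ j ∧ (x i, x j) ∈ H := by
    intro i j
    simp [hP]
  have hmem : (0, s ^ 2) ∈ P := (memP _ _).2 ⟨⟨by omega, by omega⟩, by omega, by rwa [hx.zero]⟩
  -- Unit steps are left out of `P`: they may be edges of the graph and cost nothing.
  have hstep : ∀ i j, i < j → j ≤ s ^ 2 → (layeredGraph n s w).AdjWith H (x i) (x j) →
      (i, j) ∈ P ∨ j = i + 1 := by
    intro i j hij hj h
    rcases h with h | h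
    · have := h.1
      rw [(hx i (by omega)).1, (hx j hj).1] at this
      exact Or.inr (by omega)
    · by_cases e : j = i + 1
      · exact Or.inr e
      · exact Or.inl ((memP _ _).2 ⟨⟨by omega, by omega⟩, by omega, h⟩)
  have := card_intervals_ge (P := P) ?_ (s ^ 2) 0 (s ^ 2) hmem (by omega)
  · have := this.trans (Nat.add_le_add_right (Nat.add_le_add_right
      (card_le_card (filter_subset _ P)) 0) 1)
    omega
  · intro i j hij
    obtain ⟨⟨_, hj⟩, hij2, hH'⟩ := (memP i j).1 hij
    obtain ⟨y, h1, h2⟩ := hc _ _ hH'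
    have l1 := layeredGraph_layer_lt_of_adjWith hH h1
    have l2 := layeredGraph_layer_lt_of_adjWith hH h2
    have li := (hx i (by omega)).1
    have lj := (hx j (by omega)).1
    -- Shortcut edges create no reachability, so the certifying vertex lies between two points of
    -- the line, hence on it.
    have hy := mem_line_of_reach hw hr (by omega) (hx.shift (by omega) (by omega))
      (hH.reach_of_adjWith h1) (hH.reach_of_adjWith h2)
    obtain ⟨k, hk⟩ : ∃ k, k = (y : ℕ) / w - (u : ℕ) / w := ⟨_, rfl⟩
    have lk := (hx k (by omega)).1
    have hyk : y = x k := by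
      refine eq_of_layer_eq (w := w) (by omega) ?_
      rw [hy, hx.shift (i := i) (j := k) (by omega) (by omega),
        show (y : ℕ) / w = (x k : ℕ) / w by omega]
    subst hyk
    exact ⟨k, by omega, by omega, hstep _ _ (by omega) (by omega) h1,
      hstep _ _ (by omega) (by omega) h2⟩

/-- Distinct segments share at most one edge. -/
theorem eq_of_eq {u' : Fin n} {x' : ℕ → Fin n} (hw : s ^ 10 ≤ w) (hs : 2 ≤ s)
    (hx : IsLineSegment s w u x) (hx' : IsLineSegment s w u' x') {i j i' j' : ℕ}
    (hij : i + 2 ≤ j) (hj : j ≤ s ^ 2) (hij' : i' + 2 ≤ j') (hj' : j' ≤ s ^ 2)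
    (h1 : x i = x' i') (h2 : x j = x' j') : u = u' := by
  have h4 : 4 ≤ s ^ 2 := by nlinarith
  have hr : (u : ℕ) / w % s ^ 2 < s ^ 2 := Nat.mod_lt _ (by omega)
  have hr' : (u' : ℕ) / w % s ^ 2 < s ^ 2 := Nat.mod_lt _ (by omega)
  have li := (hx i (by omega)).1
  have lj := (hx j (by omega)).1
  have li' := (hx' i' (by omega)).1
  have e1 := hx.shift (i := i) (j := j) (by omega) hj
  have e2 := hx'.shift (i := i') (j := j') (by omega) hj'
  rw [← h1, ← h2, e1] at e2
  have hdig := eq_lineDigit_of_sum_eq hw (by omega) hr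
    (a := lineDigit s ((u' : ℕ) / w % s ^ 2)) (fun i => lineDigit_lt hr') (add_left_cancel e2).symm
  -- Two consecutive layers have both parities and so reveal both digits of the direction; this is
  -- why pairs at distance one are excluded.
  have d1 := hdig ((x i : ℕ) / w) (mem_Ico.2 (by omega))
  have d2 := hdig ((x i : ℕ) / w + 1) (mem_Ico.2 (by omega))
  have hrr : (u' : ℕ) / w % s ^ 2 = (u : ℕ) / w % s ^ 2 := by
    unfold lineDigit at d1 d2
    rw [← Nat.div_add_mod ((u' : ℕ) / w % s ^ 2) s, ← Nat.div_add_mod ((u : ℕ) / w % s ^ 2) s]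
    rcases Nat.even_or_odd ((x i : ℕ) / w) with he | he
    · rw [if_pos he, if_pos he] at d1
      rw [if_neg (Nat.not_even_iff_odd.2 he.add_one), if_neg (Nat.not_even_iff_odd.2 he.add_one)]
        at d2
      rw [d1, d2]
    · rw [if_neg (Nat.not_even_iff_odd.2 he), if_neg (Nat.not_even_iff_odd.2 he)] at d1
      rw [if_pos he.add_one, if_pos he.add_one] at d2
      rw [d1, d2]
  -- The direction is the starting layer modulo `s ^ 2`, and both starting layers lie in a window of
  -- fewer than `s ^ 2` layers ending at the common point.
  have hl : (u : ℕ) / w = (u' : ℕ) / w := by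
    have key : ∀ p q : ℕ, p % s ^ 2 = q % s ^ 2 → p ≤ q → q < p + s ^ 2 → p = q := by
      intro p q h hle hlt
      have hdvd := (Nat.modEq_iff_dvd' hle).1 h
      by_contra hne
      have := Nat.le_of_dvd (by omega) hdvd
      omega
    rw [h1] at li
    rcases le_total ((u : ℕ) / w) ((u' : ℕ) / w) with h | h
    · exact key _ _ hrr.symm h (by omega)
    · exact (key _ _ hrr h (by omega)).symm
  refine eq_of_layer_eq hl ?_
  have p1 := (hx i (by omega)).2
  have p2 := (hx' i' (by omega)).2
  rw [← h1, p1, ← hl, show i' = i by rw [h1] at li; omega] at p2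
  exact add_right_cancel p2

end IsLineSegment

theorem card_certified_ge [NeZero w] (hw : s ^ 10 ≤ w) (hs : 2 ≤ s)
    {H H' : Finset (Fin n × Fin n)}
    (hH : (layeredGraph n s w).ContainsChainEdges (lineCover n s w) H) (hHH' : H ⊆ H')
    (hH' : (layeredGraph n s w).IsShortcut H') (hc : (layeredGraph n s w).IsCertified H') :
    (n - (s ^ 2 + 1) * w) * (s ^ 2 - 1) ≤ #H' := by
  classical
  have hex : ∀ u : Fin n, ∃ x : ℕ → Fin n, (u : ℕ) + (s ^ 2 + 1) * w ≤ n →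
      IsLineSegment s w u x := by
    intro u
    by_cases hu : (u : ℕ) + (s ^ 2 + 1) * w ≤ n
    · obtain ⟨x, hx⟩ := exists_isLineSegment (NeZero.pos w) hu
      exact ⟨x, fun _ => hx⟩
    · exact ⟨fun _ => u, fun h => absurd h hu⟩
  choose x hx using hex
  set U : Finset (Fin n) := {u | (u : ℕ) + (s ^ 2 + 1) * w < n} with hU
  have hUcard : n - (s ^ 2 + 1) * w ≤ #U := by
    rw [← card_range (n - (s ^ 2 + 1) * w)]
    refine card_le_card_of_surjOn (fun u : Fin n => (u : ℕ)) fun i hi => ?_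
    have hi := mem_range.1 (mem_coe.1 hi)
    exact ⟨⟨i, by omega⟩, by simp only [hU, coe_filter, mem_univ, true_and, Set.mem_ofPred_eq]; omega,
      rfl⟩
  have hUx : ∀ u ∈ U, IsLineSegment s w u (x u) := fun u hu => hx u (mem_filter.1 hu).2.le
  set P : Fin n → Finset (ℕ × ℕ) := fun u => {e ∈ range (s ^ 2 + 1) ×ˢ range (s ^ 2 + 1) |
      e.1 + 2 ≤ e.2 ∧ (x u e.1, x u e.2) ∈ H'} with hP
  have hPcard : ∀ u ∈ U, s ^ 2 - 1 ≤ #(P u) := fun u hu =>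
    (hUx u hu).card_ge hw hs hH' hc (hHH' ((hUx u hu).mem_of_containsChainEdges hs hH))
  have memP : ∀ u i j, (i, j) ∈ P u → j ≤ s ^ 2 ∧ i + 2 ≤ j ∧ (x u i, x u j) ∈ H' := by
    intro u i j h
    simp only [hP, mem_filter, mem_product, mem_range] at h
    exact ⟨by omega, h.2⟩
  calc (n - (s ^ 2 + 1) * w) * (s ^ 2 - 1) ≤ #U * (s ^ 2 - 1) := Nat.mul_le_mul_right _ hUcard
    _ ≤ ∑ u ∈ U, #(P u) := by simpa using card_nsmul_le_sum U _ _ hPcard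
    _ = #(U.sigma P) := (card_sigma _ _).symm
    _ ≤ #H' := by
      -- A shortcut edge determines its segment, and the layers of its ends determine the positions
      -- on it.
      refine card_le_card_of_injOn (fun q => (x q.1 q.2.1, x q.1 q.2.2)) ?_ ?_
      · rintro ⟨u, i, j⟩ hq
        exact (memP u i j (mem_sigma.1 (mem_coe.1 hq)).2).2.2
      · rintro ⟨u, i, j⟩ hq ⟨u', i', j'⟩ hq' he
        obtain ⟨hu, hp⟩ := mem_sigma.1 (mem_coe.1 hq)
        obtain ⟨hu', hp'⟩ := mem_sigma.1 (mem_coe.1 hq')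
        obtain ⟨h1, h2, -⟩ := memP _ _ _ hp
        obtain ⟨h1', h2', -⟩ := memP _ _ _ hp'
        obtain ⟨he1, he2⟩ := Prod.mk.inj he
        dsimp only at he1 he2 h1 h2 h1' h2' hu hu'
        obtain rfl := (hUx u hu).eq_of_eq hw hs (hUx u' hu') h2 h1 h2' h1' he1 he2
        have l1 := congrArg (fun v : Fin n => (v : ℕ) / w) he1
        have l2 := congrArg (fun v : Fin n => (v : ℕ) / w) he2
        rw [(hUx u hu i (by omega)).1, (hUx u hu i' (by omega)).1] at l1
        rw [(hUx u hu j (by omega)).1, (hUx u hu j' (by omega)).1] at l2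
        obtain rfl : i = i' := by omega
        obtain rfl : j = j' := by omega
        rfl

theorem certComplexity_ge [NeZero w] (hw : s ^ 10 ≤ w) (hs : 2 ≤ s) {H : Finset (Fin n × Fin n)}
    (hH : (layeredGraph n s w).IsShortcut H)
    (hc : (layeredGraph n s w).ContainsChainEdges (lineCover n s w) H) :
    (n - (s ^ 2 + 1) * w) * (s ^ 2 - 1) ≤ (layeredGraph n s w).certComplexity H := by
  obtain ⟨H₀, h₀⟩ := Digraph.exists_certified_superset hH
  obtain ⟨H', h1, h2, h3, h4⟩ := Nat.sInf_mem (s := {k | ∃ H' : Finset (Fin n × Fin n), H ⊆ H' ∧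
    (layeredGraph n s w).IsShortcut H' ∧ (layeredGraph n s w).IsCertified H' ∧ H'.card = k})
    ⟨_, H₀, h₀.1, h₀.2.1, h₀.2.2, rfl⟩
  exact (card_certified_ge hw hs hc h1 h2 h3).trans h4.le

/-! ### Number of edges -/

theorem numEdges_layeredGraph_le : (layeredGraph n s w).numEdges ≤ n * s := by
  classical
  have hex : ∀ u v : Fin n, ∃ a, (layeredGraph n s w).Adj u v → a < s ∧
      ((v : ℕ) : ZMod w) = ((u : ℕ) : ZMod w) + (stepShift s ((u : ℕ) / w) a : ℕ) := by
    intro u v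
    by_cases h : (layeredGraph n s w).Adj u v
    · obtain ⟨_, a, ha⟩ := h
      exact ⟨a, fun _ => ha⟩
    · exact ⟨0, fun h' => absurd h' h⟩
  choose a ha using hex
  have hle : (layeredGraph n s w).numEdges ≤
      (((univ : Finset (Fin n)) ×ˢ range s : Finset (Fin n × ℕ)) : Set (Fin n × ℕ)).ncard := by
    refine Set.ncard_le_ncard_of_injOn (fun e : Fin n × Fin n => (e.1, a e.1 e.2)) ?_ ?_
      (finite_toSet _)
    · rintro ⟨u, v⟩ h
      exact mem_coe.2 (mem_product.2 ⟨mem_univ _, mem_range.2 (ha u v h).1⟩)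
    · rintro ⟨u, v⟩ h ⟨u', v'⟩ h' he
      obtain ⟨rfl, e⟩ := Prod.mk.inj he
      dsimp only at e
      obtain rfl : v = v' := by
        refine eq_of_layer_eq (h.1.trans h'.1.symm) ?_
        rw [(ha u v h).2, (ha u v' h').2, e]
      rfl
  simpa using hle

theorem stepShift_strictMono (s t : ℕ) (hs : 0 < s) : StrictMono (stepShift s t) := by
  intro a b hab
  unfold stepShift
  have : s ^ 6 * a ^ 2 ≤ s ^ 6 * b ^ 2 := by gcongr
  refine Nat.add_lt_add_of_lt_of_le ?_ this
  split_ifs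
  · exact hab
  · gcongr

/-- A vertex more than `2 * w` before the end has a full next layer, and its `s` shifts are distinct
and below `w`, so it has `s` distinct heads. -/
theorem le_numEdges_layeredGraph (hw : s ^ 10 ≤ w) (hs : 0 < s) :
    (n - 2 * w) * s ≤ (layeredGraph n s w).numEdges := by
  classical
  have hw0 : 0 < w := (by positivity : 0 < s ^ 10).trans_le hw
  have hex : ∀ (u : Fin n) (a : ℕ), ∃ v : Fin n, (u : ℕ) + 2 * w ≤ n →
      (v : ℕ) / w = (u : ℕ) / w + 1 ∧
      ((v : ℕ) : ZMod w) = ((u : ℕ) : ZMod w) + (stepShift s ((u : ℕ) / w) a : ℕ) := by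
    intro u a
    by_cases hu : (u : ℕ) + 2 * w ≤ n
    · have hlt : ((u : ℕ) / w + 1 + 1) * w ≤ n := by
        have := layer_mul_le (w := w) u
        linarith
      obtain ⟨v, hv⟩ := exists_vertex hw0 hlt _
      exact ⟨v, fun _ => hv⟩
    · exact ⟨u, fun h => absurd h hu⟩
  choose f hf using hex
  set U : Finset (Fin n) := {u | (u : ℕ) + 2 * w < n} with hU
  have hUcard : n - 2 * w ≤ #U := by
    rw [← card_range (n - 2 * w)]
    refine card_le_card_of_surjOn (fun u : Fin n => (u : ℕ)) fun i hi => ?_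
    have hi := mem_range.1 (mem_coe.1 hi)
    exact ⟨⟨i, by omega⟩, by simp only [hU, coe_filter, mem_univ, true_and, Set.mem_ofPred_eq]; omega,
      rfl⟩
  calc (n - 2 * w) * s ≤ #U * s := Nat.mul_le_mul_right _ hUcard
    _ = ((U ×ˢ range s : Finset (Fin n × ℕ)) : Set (Fin n × ℕ)).ncard := by
      rw [Set.ncard_coe_finset, card_product, card_range]
    _ ≤ (layeredGraph n s w).numEdges := by
      refine Set.ncard_le_ncard_of_injOn (fun e : Fin n × ℕ => (e.1, f e.1 e.2)) ?_ ?_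
        (Set.toFinite _)
      · rintro ⟨u, a⟩ h
        obtain ⟨hu, ha⟩ := mem_product.1 (mem_coe.1 h)
        obtain ⟨h1, h2⟩ := hf u a (mem_filter.1 hu).2.le
        exact ⟨h1, a, mem_range.1 ha, h2⟩
      · rintro ⟨u, a⟩ h ⟨u', a'⟩ h' he
        obtain ⟨hu, ha⟩ := mem_product.1 (mem_coe.1 h)
        obtain ⟨-, ha'⟩ := mem_product.1 (mem_coe.1 h')
        obtain ⟨rfl, e⟩ := Prod.mk.inj he
        dsimp only at e hu ha ha'
        have e1 := (hf u a (mem_filter.1 hu).2.le).2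
        rw [e, (hf u a' (mem_filter.1 hu).2.le).2] at e1
        have e2 := add_left_cancel e1
        have hlt : ∀ b ∈ range s, stepShift s ((u : ℕ) / w) b < w := fun b hb =>
          (stepShift_lt (mem_range.1 hb)).trans_le
            ((Nat.pow_le_pow_right hs (by norm_num)).trans hw)
        rw [ZMod.natCast_eq_natCast_iff', Nat.mod_eq_of_lt (hlt _ ha'),
          Nat.mod_eq_of_lt (hlt _ ha)] at e2
        rw [(stepShift_strictMono s _ hs).injective e2]

end lowerBound

/-! ### Choice of parameters and conclusion -/

/-- The parameters: `s` is about `n ^ ε`, and `w * s ^ 2` about `n ^ (1 / 2)`. -/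
theorem exists_parameters {ε : ℝ} (hε0 : 0 ≤ ε) (hε1 : ε < 1 / 50) :
    ∃ N : ℕ, ∀ n : ℕ, N ≤ n → ∃ s w : ℕ, 2 ≤ s ∧ s ^ 10 ≤ w ∧ (n : ℝ) ^ ε ≤ s ∧
      (s : ℝ) ≤ 3 * (n : ℝ) ^ ε ∧ 1 / 4 * (n : ℝ) ^ (1 / 2 : ℝ) ≤ (w * s ^ 2 : ℕ) ∧
      ((w * s ^ 2 : ℕ) : ℝ) ≤ (n : ℝ) ^ (1 / 2 : ℝ) ∧ 2 * ((s ^ 2 + 1) * w) ≤ n := by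
  -- This makes `n ^ (1 / 4)` absorb the constants in `4 * s ^ 12 ≤ 4 * (3 * n ^ ε) ^ 12`.
  refine ⟨(4 * 3 ^ 12) ^ 4, fun n hn => ?_⟩
  have hnR : (((4 * 3 ^ 12) ^ 4 : ℕ) : ℝ) ≤ n := by exact_mod_cast hn
  have hn1 : (1 : ℝ) ≤ n := le_trans (by norm_num) hnR
  have hn0 : (0 : ℝ) < n := by linarith
  have hp1 : 1 ≤ (n : ℝ) ^ ε := Real.one_le_rpow hn1 hε0
  -- The added `1` keeps `2 ≤ s` even when `ε = 0`.
  set s := ⌈(n : ℝ) ^ ε⌉₊ + 1 with hs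
  have hs1 : (n : ℝ) ^ ε ≤ s := by
    rw [hs]; push_cast; linarith [Nat.le_ceil ((n : ℝ) ^ ε)]
  have hs2 : (s : ℝ) ≤ 3 * (n : ℝ) ^ ε := by
    rw [hs]; push_cast; linarith [Nat.ceil_lt_add_one (zero_le_one.trans hp1)]
  have hs3 : 2 ≤ s := by
    have : 0 < ⌈(n : ℝ) ^ ε⌉₊ := Nat.ceil_pos.2 (by linarith)
    omega
  have hquarter : (4 * 3 ^ 12 : ℝ) ≤ (n : ℝ) ^ (1 / 4 : ℝ) := by
    have := Real.rpow_le_rpow (by positivity) hnR (by norm_num : (0 : ℝ) ≤ 1 / 4)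
    refine le_trans (le_of_eq ?_) this
    rw [show (((4 * 3 ^ 12) ^ 4 : ℕ) : ℝ) = (4 * 3 ^ 12 : ℝ) ^ (4 : ℝ) by norm_num,
      ← Real.rpow_mul (by positivity)]
    norm_num
  have hpow : 4 * (s : ℝ) ^ 12 ≤ (n : ℝ) ^ (1 / 2 : ℝ) := by
    -- Here `ε < 1 / 50` enters: `12 * ε < 1 / 4`.
    have h12 : ((n : ℝ) ^ ε) ^ 12 ≤ (n : ℝ) ^ (1 / 4 : ℝ) := by
      rw [← Real.rpow_natCast, ← Real.rpow_mul hn0.le]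
      exact Real.rpow_le_rpow_of_exponent_le hn1 (by push_cast; linarith)
    calc 4 * (s : ℝ) ^ 12 ≤ 4 * (3 * (n : ℝ) ^ ε) ^ 12 := by gcongr
      _ = (4 * 3 ^ 12) * ((n : ℝ) ^ ε) ^ 12 := by ring
      _ ≤ (n : ℝ) ^ (1 / 4 : ℝ) * (n : ℝ) ^ (1 / 4 : ℝ) := by gcongr
      _ = (n : ℝ) ^ (1 / 2 : ℝ) := by rw [← Real.rpow_add hn0]; norm_num
  have hsqrt : (n : ℝ) ^ (1 / 2 : ℝ) = √n := (Real.sqrt_eq_rpow _).symm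
  rw [hsqrt] at hpow ⊢
  have hq1 : ((Nat.sqrt n : ℕ) : ℝ) ≤ √n := Real.nat_sqrt_le_real_sqrt
  have hq2 : √n < (Nat.sqrt n : ℕ) + 1 := Real.real_sqrt_lt_nat_sqrt_succ
  have hqpow : 2 * s ^ 12 ≤ Nat.sqrt n := by
    have h1 : (1 : ℝ) ≤ (s : ℝ) ^ 12 := one_le_pow₀ (by linarith)
    have : ((2 * s ^ 12 : ℕ) : ℝ) ≤ (Nat.sqrt n : ℕ) := by push_cast; linarith
    exact_mod_cast this
  have hs0 : 0 < s ^ 2 := by positivity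
  have hdm := Nat.div_add_mod (Nat.sqrt n) (s ^ 2)
  have hml := Nat.mod_lt (Nat.sqrt n) hs0
  have hs12 : s ^ 2 ≤ s ^ 12 := Nat.pow_le_pow_right (by omega) (by norm_num)
  refine ⟨s, Nat.sqrt n / s ^ 2, hs3, ?_, hs1, hs2, ?_, ?_, ?_⟩
  · rw [Nat.le_div_iff_mul_le hs0, ← pow_add]
    norm_num
    omega
  · have h1 : Nat.sqrt n ≤ 2 * (Nat.sqrt n / s ^ 2 * s ^ 2) := by
      rw [mul_comm (_ / _)]; omega
    have h2 : ((Nat.sqrt n : ℕ) : ℝ) ≤ 2 * (Nat.sqrt n / s ^ 2 * s ^ 2 : ℕ) := by exact_mod_cast h1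
    have h3 : (1 : ℝ) ≤ (Nat.sqrt n : ℕ) := by
      have : 1 ≤ Nat.sqrt n := by omega
      exact_mod_cast this
    linarith
  · exact le_trans (by exact_mod_cast Nat.div_mul_le_self _ _) hq1
  · have h4 : 4 ≤ Nat.sqrt n := by
      have : 4 ≤ s ^ 2 := by nlinarith
      omega
    have h5 : (s ^ 2 + 1) * (Nat.sqrt n / s ^ 2) ≤ 2 * Nat.sqrt n := by
      have h6 : Nat.sqrt n / s ^ 2 ≤ Nat.sqrt n := Nat.div_le_self _ _
      have h7 := Nat.mul_div_le (Nat.sqrt n) (s ^ 2)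
      linarith [add_mul (s ^ 2) 1 (Nat.sqrt n / s ^ 2)]
    calc _ ≤ 2 * (2 * Nat.sqrt n) := Nat.mul_le_mul_left 2 h5
      _ = 4 * Nat.sqrt n := by ring
      _ ≤ Nat.sqrt n * Nat.sqrt n := Nat.mul_le_mul_right _ h4
      _ ≤ n := Nat.sqrt_le n

theorem mainTheorem11 (ε : ℝ) (hε0 : 0 ≤ ε) (hε1 : ε < 1 / 50) :
    ∃ m₁ m₂ a b K c : ℝ, 0 < m₁ ∧ 0 < m₂ ∧ 0 < a ∧ 0 < b ∧ 0 < K ∧ 0 < c ∧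
      ∃ N : ℕ, ∀ n : ℕ, N ≤ n →
        ∃ (G : Digraph (Fin n)) (ℓ : ℕ) (C : Finset (List (Fin n))),
          G.IsDAG ∧
          m₁ * (n : ℝ) ^ (1 + ε) ≤ (G.numEdges : ℝ) ∧
          (G.numEdges : ℝ) ≤ m₂ * (n : ℝ) ^ (1 + ε) ∧
          a * (n : ℝ) ^ (1 / 2 : ℝ) ≤ (ℓ : ℝ) ∧
          (ℓ : ℝ) ≤ b * (n : ℝ) ^ (1 / 2 : ℝ) ∧
          G.IsChainCover ℓ K C ∧
          ∀ H : Finset (Fin n × Fin n), G.IsShortcut H → G.ContainsChainEdges C H →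
            c * ((G.numEdges : ℝ) * (n : ℝ) ^ ε) ≤ (G.certComplexity H : ℝ) := by
  obtain ⟨N, hN⟩ := exists_parameters hε0 hε1
  -- At most half of the vertices are too near the end, which gives `m₁ = 1 / 2`; with `s ^ 2 ≤ 2 *
  -- (s ^ 2 - 1)` it gives `c = 1 / 4`. The value `m₂ = 3` is the factor in the bound on `s`.
  refine ⟨1 / 2, 3, 1 / 4, 1, 1, 1 / 4, by norm_num, by norm_num, by norm_num, by norm_num,
    by norm_num, by norm_num, N + 1, fun n hn => ?_⟩
  obtain ⟨s, w, hs, hw, hs1, hs2, hl1, hl2, hn2⟩ := hN n (by omega)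
  have hw0 : 0 < w := (by positivity : 0 < s ^ 10).trans_le hw
  have : NeZero w := ⟨hw0.ne'⟩
  have h4 : 4 ≤ s ^ 2 := by nlinarith
  have hn0 : (0 : ℝ) < n := by exact_mod_cast (by omega : 0 < n)
  have hpow : (n : ℝ) ^ (1 + ε) = n * (n : ℝ) ^ ε := by rw [Real.rpow_add hn0, Real.rpow_one]
  have hp0 : 0 ≤ (n : ℝ) ^ ε := by positivity
  have hup : ((layeredGraph n s w).numEdges : ℝ) ≤ n * s := by
    exact_mod_cast numEdges_layeredGraph_le
  refine ⟨layeredGraph n s w, w * s ^ 2, lineCover n s w, layeredGraph_isDAG, ?_, ?_, hl1,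
    by rwa [one_mul], lineCover_isChainCover (by omega), fun H hH hc => ?_⟩
  · have h1 : n * s ≤ 2 * (layeredGraph n s w).numEdges := by
      have h2 : n ≤ 2 * (n - 2 * w) := by
        have := Nat.mul_le_mul_right w (by omega : 2 ≤ s ^ 2 + 1)
        omega
      have := le_numEdges_layeredGraph (n := n) hw (by omega)
      nlinarith [Nat.mul_le_mul_right s h2]
    have h3 : (n : ℝ) * s ≤ 2 * (layeredGraph n s w).numEdges := by exact_mod_cast h1
    rw [hpow]
    nlinarith [mul_le_mul_of_nonneg_left hs1 hn0.le]
  · rw [hpow]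
    nlinarith [mul_le_mul_of_nonneg_left hs2 hn0.le]
  · have h1 : n * s ^ 2 ≤ 4 * (layeredGraph n s w).certComplexity H := by
      have h2 := certComplexity_ge hw hs hH hc
      have h3 : n ≤ 2 * (n - (s ^ 2 + 1) * w) := by omega
      have h5 : s ^ 2 ≤ 2 * (s ^ 2 - 1) := by omega
      nlinarith [Nat.mul_le_mul h3 h5]
    have h6 : (n : ℝ) * (s : ℝ) ^ 2 ≤ 4 * (layeredGraph n s w).certComplexity H := by
      exact_mod_cast h1
    have h7 : ((layeredGraph n s w).numEdges : ℝ) * (n : ℝ) ^ ε ≤ n * s * s :=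
      mul_le_mul hup hs1 hp0 (by positivity)
    nlinarith
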